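/- Let $F/\mathbf{F}_q$ be an algebraic function field of one variable over a finite field, and let $Q, P_1, \dots, P_n$ ($n \ge 1$) be distinct places of degree one, with $v_Q$ the normalized discrete valuation at $Q$. For an integer $u$ let $\mathcal{L}(uQ)$ be the Riemann–Roch space, $\mathrm{ev}(f) = (f(P_1), \dots, f(P_n))$ and $C_u = \mathrm{ev}(\mathcal{L}(uQ))$. Let $H(Q) = \{m \ge 0 \mid \text{some } f \in F \text{ has pole divisor } mQ\}$ be the Weierstrass semigroup, and $\widehat{H}(Q) = \{u \in H(Q) \mid C_u \ne C_{u-1}\}$. Let $a_1, \dots, a_t$ be positive integers generating $H(Q)$, and let $x_1, \dots, x_t \in F$ have pole divisors $(x_i)_\infty = a_i Q$. Order $\mathbf{N}_0^t$ by $m \prec m'$ if $\sum_k a_k m_k < \sum_k a_k m'_k$, or if these sums are equal and $m_k > m'_k$ at the first index $k$ with $m_k \ne m'_k$. For $0 \le i < a_1$ put $b_i = \min\{m \in H(Q) \mid m \equiv i \pmod{a_1}\}$, let $L_i = (\ell_{i1}, \dots, \ell_{it})$ be the $\prec$-least vector with $\sum_k a_k \ell_{ik} = b_i$ (then $\ell_{i1}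 = 0$), and put $y_i = x_2^{\ell_{i2}} \cdots x_t^{\ell_{it}}$. The monomials $x_1^j y_i$ ($j \ge 0$, $0 \le i < a_1$), with exponent vectors $L_i + (j, 0, \dots, 0)$, form an $\mathbf{F}_q$-basis of $\mathcal{L}(\infty Q) = \bigcup_u \mathcal{L}(uQ)$; the leading monomial $\mathrm{LM}(f)$ of a nonzero $f \in \mathcal{L}(\infty Q)$ is the $\prec$-greatest one occurring in $f$. For $s \in H(Q)$ let $\varphi_s$ be the unique monomial $x_1^j y_i$ with $-v_Q(x_1^j y_i) = s$, and for $\Gamma \subseteq \widehat{H}(Q)$ let $C_\Gamma$ be the $\mathbf{F}_q$-span of $\{\mathrm{ev}(\varphi_s) \mid s \in \Gamma\}$. With $D = P_1 + \cdots + P_n$, for each $0 \le i < a_1$ let $\eta_i$ be any element of $\mathcal{L}(-D + \infty Q) = \bigcup_u \mathcal{L}(-D + uQ)$ with $\mathrm{LM}(\eta_i) = x_1^j y_i$ for the least $j$ that is possible for this $i$. Put $$\nu(s) = \frac{1}{a_1} \sum_{0 \le i < a_1} \max\{-v_Q(\eta_{i'}) + v_Q(y_i) - s,\, 0\}, \qquad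 i' = (i + s) \bmod a_1,$$ $$\lambda(s) = \sharp\{j \in H(Q) \mid j + s \in \widehat{H}(Q)\}.$$ For nonempty $\Gamma \subseteq \widehat{H}(Q)$ let $d_{\mathrm{AG}}(C_\Gamma) = \min_{s \in \Gamma} \lambda(s)$ (the Andersen–Geil bound) and $d_{\mathrm{LBAO}}(C_\Gamma) = \min_{s \in \Gamma} \nu(s)$. The number $\lfloor (d_{\mathrm{LBAO}} - 1)/2 \rfloor$ is the decoding radius of Lee, Bras-Amorós and O'Sullivan. Then for every $\Gamma \subseteq \widehat{H}(Q)$ and every $s \in \Gamma$, the number $\lambda(s)$ is finite and $\nu(s) = \lambda(s)$. Consequently, if $\Gamma \ne \emptyset$, then $d_{\mathrm{LBAO}}(C_\Gamma) = d_{\mathrm{AG}}(C_\Gamma)$ and $$\left\lfloor \frac{d_{\mathrm{LBAO}}(C_\Gamma) - 1}{2} \right\rfloor = \left\lfloor \frac{d_{\mathrm{AG}}(C_\Gamma) - 1}{2} \right\rfloor .$$ This covers every one-point code: for each integer $u \ge 0$ the set $\Gamma_u = \{s \in \widehat{H}(Q) \mid s \le u\}$ is nonempty and $C_{\Gamma_u}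 = C_u$, so $d_{\mathrm{LBAO}}(C_{\Gamma_u}) = d_{\mathrm{AG}}(C_{\Gamma_u})$. If moreover every $s \in H(Q)$ with $s \le u$ lies in $\widehat{H}(Q)$, then the original quantity $d_{\mathrm{LBAO}}(C_u) = \min\{\nu(s) \mid s \in H(Q),\ s \le u\}$ equals $d_{\mathrm{AG}}(C_{\Gamma_u})$, and $\lfloor (d_{\mathrm{LBAO}}(C_u) - 1)/2 \rfloor = \lfloor (d_{\mathrm{AG}}(C_{\Gamma_u}) - 1)/2 \rfloor$. -/

import Mathlib

open scoped WithZero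

noncomputable section

namespace OnePointCode

/-- A place of the function field `F/K`, given by its normalized discrete valuation: a surjective
valuation `F → ℤᵐ⁰`, trivial on `K`. The values are written multiplicatively, so that the additive
valuation is `v_P(f) = - log (P f)`; thus `v_P(f) ≥ 0` reads `P f ≤ 1` and `v_P(f) ≥ 1` reads
`P f < 1`. -/
structure Place (K F : Type*) [Field K] [Field F] [Algebra K F] where
  /-- The normalized discrete valuation of the place. -/
  val : Valuation F ℤᵐ⁰
  surjective : Function.Surjective val
  trivial_on_const : ∀ c : K, c ≠ 0 → val (algebraMap K F c) = 1

section

variable {K F : Type*} [Field K] [Field F] [Algebra K F]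

/-- The place has degree one: the constants `K` exhaust its residue field. -/
def Place.IsRational (P : Place K F) : Prop :=
  ∀ f : F, P.val f ≤ 1 → ∃ c : K, P.val (f - algebraMap K F c) < 1

/-- `-v_P(f)`, for `f ≠ 0` (and `0` for `f = 0`). -/
def Place.negOrd (P : Place K F) (f : F) : ℤ := WithZero.log (P.val f)

open Classical in
/-- The value `f(P) ∈ K` of `f` at a place `P` of degree one at which `f` is regular: the constant
`c` with `v_P(f - c) ≥ 1`. -/
def Place.eval (P : Place K F) (f : F) : K :=
  if h : ∃ c : K, P.val (f - algebraMap K F c) < 1 then h.choose else 0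

/-- The Riemann-Roch space `𝓛(G) = {f | f = 0 or (f) + G ≥ 0}` of a divisor `G`. -/
def rrSpace (G : Place K F →₀ ℤ) : Set F :=
  {f | f = 0 ∨ ∀ P : Place K F, P.negOrd f ≤ G P}

/-- `f ≠ 0` has pole divisor `(f)_∞ = G`. -/
def HasPoleDivisor (f : F) (G : Place K F →₀ ℤ) : Prop :=
  f ≠ 0 ∧ ∀ P : Place K F, max (P.negOrd f) 0 = G P

/-- The Weierstrass semigroup `H(Q)`: all `m` such that some `f` has pole divisor `mQ`. -/
def weierstrass (Q : Place K F) : Set ℕ :=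
  {m | ∃ f : F, HasPoleDivisor f (Finsupp.single Q (m : ℤ))}

/-- `𝓛(-D + ∞Q) = ⋃ i, 𝓛(-D + iQ)` with `D = P₁ + ⋯ + Pₙ`. -/
def idealSpace {n : ℕ} (Q : Place K F) (P : Fin n → Place K F) : Set F :=
  ⋃ i : ℕ, rrSpace (Finsupp.single Q (i : ℤ) - ∑ k, Finsupp.single (P k) 1)

/-- The evaluation map `ev(f) = (f(P₁), …, f(Pₙ))`. -/
def ev {n : ℕ} (P : Fin n → Place K F) (f : F) : Fin n → K := fun k => (P k).eval f

/-- The one-point code `C_u = ev(𝓛(uQ))`, for an integer `u`. -/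
def code {n : ℕ} (Q : Place K F) (P : Fin n → Place K F) (u : ℤ) : Set (Fin n → K) :=
  ev P '' rrSpace (Finsupp.single Q u)

/-- `Ĥ(Q) = {u ∈ H(Q) | C_u ≠ C_{u-1}}`. -/
def hatH {n : ℕ} (Q : Place K F) (P : Fin n → Place K F) : Set ℕ :=
  {u | u ∈ weierstrass Q ∧ code Q P (u : ℤ) ≠ code Q P ((u : ℤ) - 1)}

/-- The set `{j ∈ H(Q) | j + s ∈ Ĥ(Q)}`. -/
def lambdaSet {n : ℕ} (Q : Place K F) (P : Fin n → Place K F) (s : ℕ) : Set ℕ :=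
  {j | j ∈ weierstrass Q ∧ j + s ∈ hatH Q P}

/-- `λ(s)`, the number of elements of `{j ∈ H(Q) | j + s ∈ Ĥ(Q)}`. -/
def lambda {n : ℕ} (Q : Place K F) (P : Fin n → Place K F) (s : ℕ) : ℕ :=
  (lambdaSet Q P s).ncard

/-- The Andersen-Geil bound `d_AG(C_Γ) = min {λ(s) | s ∈ Γ}` (for nonempty `Γ`). -/
def dAG {n : ℕ} (Q : Place K F) (P : Fin n → Place K F) (Γ : Set ℕ) : ℕ :=
  sInf (lambda Q P '' Γ)

end

section

/-! In this section `a` holds the generators; `a 0` is the one written `a₁` on paper. -/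

/-- The weighted degree `a₁ m₁ + ⋯ + a_t m_t`. -/
def weight {t : ℕ} (a m : Fin t → ℕ) : ℕ := ∑ k, a k * m k

/-- The weighted reverse lexicographic monomial order, `m ≺ m'`. -/
def Prec {t : ℕ} (a m m' : Fin t → ℕ) : Prop :=
  weight a m < weight a m' ∨
    (weight a m = weight a m' ∧ ∃ i, (∀ k, k < i → m k = m' k) ∧ m' i < m i)

variable {K F : Type*} [Field K] [Field F] [Algebra K F] {t : ℕ} [NeZero t]

/-- `b_i = min {m ∈ H(Q) | m ≡ i (mod a₁)}`. -/
def apery (Q : Place K F) (a : Fin t → ℕ) (i : ℕ) : ℕ :=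
  sInf {m | m ∈ weierstrass Q ∧ m ≡ i [MOD a 0]}

open Classical in
/-- `L_i`, the `≺`-least exponent vector of weighted degree `b_i`. -/
def aperyExp (Q : Place K F) (a : Fin t → ℕ) (i : ℕ) : Fin t → ℕ :=
  if h : ∃ m, weight a m = apery Q a i ∧ ∀ m', weight a m' = apery Q a i → m' ≠ m → Prec a m m'
  then h.choose else 0

/-- `y_i = x₂ ^ ℓ_{i2} ⋯ x_t ^ ℓ_{it}`, where `L_i = (0, ℓ_{i2}, …, ℓ_{it})`. -/
def y (Q : Place K F) (a : Fin t → ℕ) (x : Fin t → F) (i : ℕ) : F :=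
  ∏ k ∈ Finset.univ.erase 0, x k ^ aperyExp Q a i k

open Classical in
/-- `φ_s`, for `s ∈ H(Q)`: the monomial `x₁ ^ k y_i` with `i < a₁` and `-v_Q(x₁ ^ k y_i) = s`. -/
def phi (Q : Place K F) (a : Fin t → ℕ) (x : Fin t → F) (s : ℕ) : F :=
  if h : ∃ p : ℕ × ℕ, p.2 < a 0 ∧ Q.negOrd (x 0 ^ p.1 * y Q a x p.2) = (s : ℤ)
  then x 0 ^ h.choose.1 * y Q a x h.choose.2 else 0

/-- The code `C_Γ`, spanned by the vectors `ev(φ_s)`, `s ∈ Γ`. -/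
def codeOf {n : ℕ} (Q : Place K F) (P : Fin n → Place K F) (a : Fin t → ℕ) (x : Fin t → F)
    (Γ : Set ℕ) : Submodule K (Fin n → K) :=
  Submodule.span K ((fun s => ev P (phi Q a x s)) '' Γ)

/-- The exponent vector of the monomial `x₁ ^ j y_i`. -/
def monoExp (Q : Place K F) (a : Fin t → ℕ) (p : ℕ × ℕ) : Fin t → ℕ :=
  fun k => if k = 0 then p.1 else aperyExp Q a p.2 k

/-- The leading monomial of `f` is `x₁ ^ j y_i`, where `p = (j, i)`: in an expression of `f` as a
`K`-linear combination of the monomials `x₁ ^ m y_k` with `k < a₁`, the monomial `x₁ ^ j y_i`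
occurs, and all others that occur are smaller with respect to `≺`. -/
def HasLeadingMonomial (Q : Place K F) (a : Fin t → ℕ) (x : Fin t → F) (f : F)
    (p : ℕ × ℕ) : Prop :=
  ∃ c : ℕ × ℕ →₀ K, (∀ r ∈ c.support, r.2 < a 0) ∧
    f = c.sum (fun r k => algebraMap K F k * (x 0 ^ r.1 * y Q a x r.2)) ∧
    p ∈ c.support ∧ ∀ r ∈ c.support, r ≠ p → Prec a (monoExp Q a r) (monoExp Q a p)

/-- `f` is an admissible choice of `η_i`: an element of `𝓛(-D + ∞Q)` with leading monomial
`x₁ ^ j y_i`, where `j` is least possible for this `i`. -/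
def IsEta {n : ℕ} (Q : Place K F) (P : Fin n → Place K F) (a : Fin t → ℕ) (x : Fin t → F)
    (i : ℕ) (f : F) : Prop :=
  f ∈ idealSpace Q P ∧ ∃ j, HasLeadingMonomial Q a x f (j, i) ∧
    ∀ h ∈ idealSpace Q P, ∀ j', HasLeadingMonomial Q a x h (j', i) → j ≤ j'

/-- `ν(s) = (1/a₁) ∑_{0 ≤ i < a₁} max {-v_Q(η_{i'}) + v_Q(y_i) - s, 0}` with
`i' = (i + s) mod a₁`. -/
def nu (Q : Place K F) (a : Fin t → ℕ) (x : Fin t → F) (η : ℕ → F) (s : ℕ) : ℝ :=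
  1 / (a 0 : ℝ) * ∑ i ∈ Finset.range (a 0),
    ((max (Q.negOrd (η ((i + s) % a 0)) - Q.negOrd (y Q a x i) - (s : ℤ)) 0 : ℤ) : ℝ)

/-- The Lee-Bras-Amorós-O'Sullivan bound `min {ν(s) | s ∈ Γ}` (for nonempty `Γ`). -/
def dLBAO (Q : Place K F) (a : Fin t → ℕ) (x : Fin t → F) (η : ℕ → F) (Γ : Set ℕ) : ℝ :=
  sInf (nu Q a x η '' Γ)

end

end OnePointCode

end

/-! Both bounds count the same integers, sorted by residue class modulo `a₁`. Pole orders at `Q` of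
elements of `𝓛(∞Q)` form `H(Q)`, which meets the class of `i` in `b_i, b_i + a₁, …`. The functions
that also vanish at all `P_k` form an ideal, stable under multiplication by `x₁`, so their pole
orders in the class of `i` are `e_i, e_i + a₁, …` with `e_i = -v_Q(η_i)`. For `m ∈ H(Q)`, `C_m =
C_{m-1}` exactly when `m` is a pole order of this ideal (`code_eq_code_sub_one_iff`); hence `m ∈
Ĥ(Q)` iff `m < e_{m mod a₁}`. So `λ(s)` counts the `j` with `b_i ≤ j < e_{i'} - s`, where `i = j mod
a₁` and `i' = (i + s) mod a₁`. Both ends are congruent to `i`, so class `i` contributes `max(e_{i'}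
- b_i - s, 0) / a₁`, and the sum is `ν(s)` (`finite_and_ncard_eq_sum`).

Two facts about function fields are needed: a nonzero function regular away from `Q` has nonnegative
pole order at `Q` (`negOrd_nonneg`, via `exists_place_one_lt`), and `H(Q)` meets every class modulo
`a₁` (`exists_mem_weierstrass_modEq`). Leading monomials translate into pole orders because distinct
monomials `x₁ ^ j y_i` have distinct pole orders (`degree_injective`). -/

section FunctionFieldValuations

/-! ### Existence of a place at which a given transcendental function has a pole. -/

open Polynomial

variable {K F : Type*} [Field K] [Field F] [Algebra K F]

/-- The transcendence degree is one, so a single algebraically independent element is already a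
basis. -/
theorem FunctionField.isTranscendenceBasis [Algebra (RatFunc K) F]
    [IsScalarTower K (RatFunc K) F] [FunctionField K F] {z : F} (hz : Transcendental K z) :
    IsTranscendenceBasis K (fun _ : Unit ↦ z) := by
  have : Algebra.IsAlgebraic K[X] (RatFunc K) := IsLocalization.isAlgebraic _ (nonZeroDivisors K[X])
  have h : IsTranscendenceBasis K (algebraMap (RatFunc K) F ∘
      (algebraMap K[X] (RatFunc K) ∘ fun _ : Unit ↦ (X : K[X]))) :=
    (IsTranscendenceBasis.polynomial (ι := Unit) (R := K)).algebraMap_comp.algebraMap_comp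
  exact (algebraicIndependent_unique_type_iff.2 hz).isTranscendenceBasis_of_lift_trdeg_le_of_finite
    h.lift_cardinalMk_eq_trdeg.ge

theorem FunctionField.isAlgebraic_adjoin_singleton [Algebra (RatFunc K) F]
    [IsScalarTower K (RatFunc K) F] [FunctionField K F] {z : F} (hz : Transcendental K z) :
    Algebra.IsAlgebraic (Algebra.adjoin K {z}) F := by
  have h := (FunctionField.isTranscendenceBasis hz).isAlgebraic
  rwa [Set.range_const] at h

theorem FunctionField.finiteDimensional_adjoin_simple [Algebra (RatFunc K) F]
    [IsScalarTower K (RatFunc K) F] [FunctionField K F] {z : F} (hz : Transcendental K z) :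
    FiniteDimensional (IntermediateField.adjoin K {z}) F := by
  have h := (FunctionField.isTranscendenceBasis hz).isAlgebraic_field
  rw [Set.range_const] at h
  have : Algebra.EssFiniteType K[X] (RatFunc K) :=
    Algebra.EssFiniteType.of_isLocalization _ (nonZeroDivisors K[X])
  have : Algebra.EssFiniteType K (RatFunc K) := .comp K K[X] _
  have : Algebra.EssFiniteType K F := .comp K (RatFunc K) _
  have : Algebra.EssFiniteType (IntermediateField.adjoin K {z}) F := .of_comp K _ _
  exact Algebra.finite_of_essFiniteType_of_isAlgebraic

/-- Nonzero constants have value `1 < v z`, so the top term of a polynomial in `z` dominates. The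
induction peels off the constant term with `divX`. -/
theorem Valuation.exists_eq_zpow_of_mem_adjoin {Γ₀ : Type*} [LinearOrderedCommGroupWithZero Γ₀]
    (v : Valuation F Γ₀) (hv : ∀ c : K, v (algebraMap K F c) ≤ 1) {z : F} (hz : 1 < v z) {w : F}
    (hw : w ∈ IntermediateField.adjoin K {z}) (hw0 : w ≠ 0) : ∃ k : ℤ, v w = v z ^ k := by
  have key (n : ℕ) : ∀ p : K[X], p.natDegree = n → p ≠ 0 → ∃ k : ℕ, v (aeval z p) = v z ^ k := by
    induction n using Nat.strong_induction_on with
    | _ n ih =>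
    intro p hpn hp
    have hc : ∀ c : K, c ≠ 0 → v (algebraMap K F c) = 1 := fun c hc ↦ by
      refine le_antisymm (hv c) ?_
      have h1 := hv c⁻¹
      rw [map_inv₀, map_inv₀] at h1
      have : 0 < v (algebraMap K F c) := by
        rw [Valuation.pos_iff]; simpa using hc
      exact (inv_le_one₀ this).1 h1
    have h := p.divX_mul_X_add
    by_cases hq : p.divX = 0
    · rw [hq, zero_mul, zero_add] at h
      refine ⟨0, ?_⟩
      rw [← h, aeval_C, pow_zero, hc]
      rintro h0
      rw [h0] at h; exact hp (by rw [← h, C_0])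
    · have hlt : p.divX.natDegree < n := by
        rw [← hpn]
        exact natDegree_lt_natDegree hq (degree_divX_lt hp)
      obtain ⟨k, hk⟩ := ih _ hlt _ rfl hq
      refine ⟨k + 1, ?_⟩
      have h1 : v (aeval z (p.divX * X)) = v z ^ (k + 1) := by
        rw [map_mul, map_mul, hk, aeval_X, pow_succ]
      rw [← h, map_add, aeval_C, Valuation.map_add_eq_of_lt_left, h1]
      rw [h1]
      exact (hv _).trans_lt (one_lt_pow₀ hz (by omega))
  obtain ⟨p, q, rfl⟩ := (IntermediateField.mem_adjoin_simple_iff K w).1 hw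
  have hp : p ≠ 0 := by rintro rfl; simp at hw0
  have hq : q ≠ 0 := by rintro rfl; simp at hw0
  obtain ⟨k, hk⟩ := key _ p rfl hp
  obtain ⟨l, hl⟩ := key _ q rfl hq
  have hz0 : v z ≠ 0 := (zero_lt_one.trans hz).ne'
  exact ⟨k - l, by rw [map_div₀, hk, hl, zpow_sub₀ hz0]; simp⟩

theorem Valuation.exists_eq_of_sum_eq_zero {ι Γ₀ : Type*} [LinearOrderedCommGroupWithZero Γ₀]
    (v : Valuation F Γ₀) (s : Finset ι) (f : ι → F) (hs : s.Nonempty) (hf : ∀ i ∈ s, f i ≠ 0)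
    (h : ∑ i ∈ s, f i = 0) : ∃ i ∈ s, ∃ j ∈ s, i ≠ j ∧ v (f i) = v (f j) := by
  classical
  by_contra! hne
  obtain ⟨i, hi, hmax⟩ := s.exists_max_image (fun i ↦ v (f i)) hs
  rw [← Finset.add_sum_erase _ _ hi] at h
  have hlt : v (∑ j ∈ s.erase i, f j) < v (f i) := by
    refine v.map_sum_lt (by simpa using hf i hi) fun j hj ↦ ?_
    rw [Finset.mem_erase] at hj
    exact lt_of_le_of_ne (hmax j hj.2) (hne j hj.2 i hi hj.1)
  have := v.map_add_eq_of_lt_left hlt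
  rw [h, map_zero] at this
  exact hf i hi (by simpa using this.symm)

/-- In the minimal equation of `h` over `K(z)` two terms must have equal value, which makes some `v
h ^ (j - i)` a power of `v z`. Since `0 < j - i ≤ [F : K(z)]`, the factorial of the degree is an
exponent that serves all `h`. -/
theorem Valuation.exists_pow_eq_zpow {Γ₀ : Type*} [LinearOrderedCommGroupWithZero Γ₀]
    (v : Valuation F Γ₀) (hv : ∀ c : K, v (algebraMap K F c) ≤ 1) {z : F} (hz : 1 < v z)
    [FiniteDimensional (IntermediateField.adjoin K {z}) F] :
    ∃ M : ℕ, 0 < M ∧ ∀ h : F, h ≠ 0 → ∃ k : ℤ, v h ^ M = v z ^ k := by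
  set E := IntermediateField.adjoin K {z}
  refine ⟨(Module.finrank E F).factorial, Nat.factorial_pos _, fun h hh ↦ ?_⟩
  set p := minpoly E h
  have hp : p ≠ 0 := minpoly.ne_zero (Algebra.IsIntegral.isIntegral h)
  have hsum : ∑ i ∈ p.support, (p.coeff i : F) * h ^ i = 0 := by
    have := minpoly.aeval E h
    rwa [aeval_def, eval₂_eq_sum, Polynomial.sum] at this
  obtain ⟨i, hi, j, hj, hij, he⟩ := v.exists_eq_of_sum_eq_zero _ _
    (by simpa using hp) (fun i hi ↦ mul_ne_zero (by simpa using hi) (pow_ne_zero _ hh)) hsum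
  wlog hlt : i < j generalizing i j
  · exact this j hj i hi hij.symm he.symm (by omega)
  have hci : (p.coeff i : F) ≠ 0 := by simpa using hi
  have hcj : (p.coeff j : F) ≠ 0 := by simpa using hj
  obtain ⟨k, hk⟩ := v.exists_eq_zpow_of_mem_adjoin hv hz
    (w := p.coeff i / p.coeff j) (by exact (p.coeff i / p.coeff j : E).2) (div_ne_zero hci hcj)
  have hvh : v h ≠ 0 := by simpa using hh
  have h1 : v h ^ (j - i) = v z ^ k := by
    rw [← hk, map_div₀, pow_sub₀ _ hvh hlt.le]
    have : v (p.coeff j) ≠ 0 := by simpa using hcj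
    have : v h ^ i ≠ 0 := pow_ne_zero _ hvh
    simp only [map_mul, map_pow] at he
    field_simp
    rw [mul_comm, ← he, mul_comm]
  have hle : j - i ≤ Module.finrank E F := by
    have := le_natDegree_of_mem_supp _ hj
    have : p.natDegree ≤ Module.finrank E F := minpoly.natDegree_le (A := E) h
    omega
  obtain ⟨m, hm⟩ := Nat.dvd_factorial (by omega) hle
  exact ⟨k * m, by rw [hm, pow_mul, h1, zpow_mul, zpow_natCast]⟩

/-- The exponent `k` is an order-reflecting homomorphism from the units of `F` to `ℤ`. Its image is
`dℤ`, and `k / d` is the normalized valuation. -/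
theorem Valuation.exists_withZero_int {Γ₀ : Type*} [LinearOrderedCommGroupWithZero Γ₀]
    (v : Valuation F Γ₀) {z : F} (hz : 1 < v z) {M : ℕ} (hM : 0 < M)
    (H : ∀ h : F, h ≠ 0 → ∃ k : ℤ, v h ^ M = v z ^ k) :
    ∃ w : Valuation F (WithZero (Multiplicative ℤ)), Function.Surjective w ∧
      ∀ h, w h ≤ 1 ↔ v h ≤ 1 := by
  classical
  choose! k hk using H
  have hz0 : z ≠ 0 := by rintro rfl; simp at hz
  have hle {g h : F} (hg : g ≠ 0) (hh : h ≠ 0) : k g ≤ k h ↔ v g ≤ v h := by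
    rw [← zpow_le_zpow_iff_right₀ hz, ← hk g hg, ← hk h hh, pow_le_pow_iff_left₀ zero_le zero_le hM.ne']
  have hinj := zpow_right_injective₀ (zero_lt_one.trans hz) hz.ne'
  have hmul {g h : F} (hg : g ≠ 0) (hh : h ≠ 0) : k (g * h) = k g + k h := by
    apply hinj
    simp only
    rw [← hk _ (mul_ne_zero hg hh), map_mul, mul_pow, hk g hg, hk h hh,
      zpow_add₀ (zero_lt_one.trans hz).ne']
  have hkz : k z = M := by
    apply hinj
    simp only
    rw [← hk z hz0, zpow_natCast]
  let S : AddSubgroup ℤ :=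
    { carrier := {n | ∃ h : F, h ≠ 0 ∧ k h = n}
      zero_mem' := ⟨1, one_ne_zero, by have := hmul (one_ne_zero' F) one_ne_zero; simp_all⟩
      add_mem' := by
        rintro _ _ ⟨g, hg, rfl⟩ ⟨h, hh, rfl⟩
        exact ⟨g * h, mul_ne_zero hg hh, hmul hg hh⟩
      neg_mem' := by
        rintro _ ⟨g, hg, rfl⟩
        refine ⟨g⁻¹, inv_ne_zero hg, ?_⟩
        have h1 := hmul hg (inv_ne_zero hg)
        have h2 := hmul (one_ne_zero' F) one_ne_zero
        rw [mul_inv_cancel₀ hg] at h1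
        rw [one_mul] at h2
        omega }
  obtain ⟨d, hd⟩ := Int.subgroup_cyclic S
  wlog hd0 : 0 ≤ d generalizing d
  · exact this (-d) (by rw [hd, AddSubgroup.closure_singleton_neg]) (by omega)
  have hdvd (h : F) (hh : h ≠ 0) : d ∣ k h := by
    have : k h ∈ S := ⟨h, hh, rfl⟩
    rwa [hd, ← AddSubgroup.zmultiples_eq_closure, Int.mem_zmultiples_iff] at this
  -- The image is nontrivial because `k z = M > 0`.
  have hdpos : 0 < d := by
    refine lt_of_le_of_ne hd0 ?_
    rintro rfl
    have := hdvd z hz0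
    rw [hkz] at this
    simp at this; omega
  obtain ⟨π, hπ, hkπ⟩ : d ∈ S := by rw [hd]; exact AddSubgroup.subset_closure rfl
  have hmono {g h : F} (hg : g ≠ 0) (hh : h ≠ 0) : k g / d ≤ k h / d ↔ v g ≤ v h := by
    rw [← hle hg hh]
    obtain ⟨a, ha⟩ := hdvd g hg
    obtain ⟨b, hb⟩ := hdvd h hh
    rw [ha, hb, Int.mul_ediv_cancel_left _ hdpos.ne', Int.mul_ediv_cancel_left _ hdpos.ne',
      mul_le_mul_iff_right₀ hdpos]
  have hk1 : k 1 = 0 := by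
    have h2 := hmul (one_ne_zero' F) one_ne_zero
    rw [one_mul] at h2; omega
  let w : Valuation F (WithZero (Multiplicative ℤ)) :=
    { toFun h := if h = 0 then 0 else WithZero.exp (k h / d)
      map_zero' := by simp
      map_one' := by simp [hk1]
      map_mul' g h := by
        by_cases hg : g = 0
        · simp [hg]
        by_cases hh : h = 0
        · simp [hh]
        simp only [mul_eq_zero, hg, hh, or_self, if_false]
        rw [hmul hg hh, Int.add_ediv_of_dvd_left (hdvd g hg), WithZero.exp_add]
      map_add_le_max' g h := by
        by_cases hg : g = 0
        · simp [hg]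
        by_cases hh : h = 0
        · simp [hh]
        by_cases hgh : g + h = 0
        · simp [hgh]
        simp only [hg, hh, hgh, if_false, le_max_iff, WithZero.exp_le_exp]
        rw [hmono hgh hg, hmono hgh hh, ← le_max_iff]
        exact v.map_add g h }
  have hw (h : F) (hh : h ≠ 0) : w h = WithZero.exp (k h / d) := if_neg hh
  refine ⟨w, fun y ↦ ?_, fun h ↦ ?_⟩
  · induction y using WithZero.expRecOn with
    | zero => exact ⟨0, map_zero _⟩
    | exp n =>
      refine ⟨π ^ n, ?_⟩
      rw [map_zpow₀, hw π hπ, hkπ, Int.ediv_self hdpos.ne', ← WithZero.exp_zsmul]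
      simp
  · by_cases hh : h = 0
    · simp [hh]
    · have := hmono hh one_ne_zero
      rw [hk1, map_one] at this
      rw [← this, hw h hh, ← WithZero.exp_zero, WithZero.exp_le_exp]
      simp

namespace OnePointCode

theorem Place.val_algebraMap_le (P : Place K F) (c : K) : P.val (algebraMap K F c) ≤ 1 := by
  by_cases hc : c = 0
  · simp [hc]
  · rw [P.trivial_on_const c hc]

theorem exists_place_one_lt [Algebra (RatFunc K) F] [IsScalarTower K (RatFunc K) F]
    [FunctionField K F] {z : F} (hz : Transcendental K z) : ∃ P : Place K F, 1 < P.val z := by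
  let C : Subring F := (integralClosure K F).toSubring
  have hzC : z ∉ C := fun h ↦ hz (IsIntegral.isAlgebraic h)
  have : IsIntegrallyClosedIn C F := inferInstanceAs (IsIntegrallyClosedIn (integralClosure K F) F)
  -- An integrally closed subring is the intersection of the valuation rings above it, so one of
  -- them omits `z`.
  obtain ⟨V, hCV, hzV⟩ := Subring.exists_le_valuationSubring_of_isIntegrallyClosedIn hzC
  have hv (c : K) : V.valuation (algebraMap K F c) ≤ 1 :=
    (V.valuation_le_one_iff _).2 (hCV (isIntegral_algebraMap (R := K)))
  have hzv : 1 < V.valuation z := by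
    rw [← not_le, V.valuation_le_one_iff]; exact hzV
  have := FunctionField.finiteDimensional_adjoin_simple hz
  obtain ⟨M, hM, H⟩ := V.valuation.exists_pow_eq_zpow hv hzv
  obtain ⟨w, hw, hwv⟩ := V.valuation.exists_withZero_int hzv hM H
  refine ⟨⟨w, hw, fun c hc ↦ ?_⟩, ?_⟩
  · have h1 := (hwv _).2 (hv c)
    have h2 := (hwv _).2 (hv c⁻¹)
    have h0 : 0 < w (algebraMap K F c) := by rw [Valuation.pos_iff]; simpa using hc
    rw [map_inv₀, map_inv₀, inv_le_one₀ h0] at h2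
    exact le_antisymm h1 h2
  · rw [← not_le]
    exact fun h ↦ hzv.not_ge ((hwv z).1 h)

end OnePointCode

end FunctionFieldValuations

/-! ### Pole orders, the ring `𝓛(∞Q)` and the Weierstrass semigroup. -/

theorem Valuation.le_one_of_isIntegral {A F Γ₀ : Type*} [CommRing A] [Field F] [Algebra A F]
    [LinearOrderedCommGroupWithZero Γ₀] (v : Valuation F Γ₀)
    (hv : ∀ a : A, v (algebraMap A F a) ≤ 1) {h : F} (hh : IsIntegral A h) : v h ≤ 1 := by
  let φ : A →+* v.integer := (algebraMap A F).codRestrict v.integer hv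
  let := φ.toAlgebra
  have : IsScalarTower A v.integer F := IsScalarTower.of_algebraMap_eq fun _ ↦ rfl
  exact (Valuation.integer.integers v).mem_of_integral (hh.tower_top (A := v.integer))

namespace OnePointCode

variable {K F : Type*} [Field K] [Field F] [Algebra K F]

section Place

variable (P : Place K F)

theorem Place.val_eq_exp {f : F} (hf : f ≠ 0) : P.val f = WithZero.exp (P.negOrd f) :=
  (WithZero.exp_log (by simpa using hf)).symm

theorem Place.negOrd_le_negOrd {f g : F} (hf : f ≠ 0) (hg : g ≠ 0) :
    P.negOrd f ≤ P.negOrd g ↔ P.val f ≤ P.val g := by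
  rw [P.val_eq_exp hf, P.val_eq_exp hg, WithZero.exp_le_exp]

theorem Place.negOrd_lt_negOrd {f g : F} (hf : f ≠ 0) (hg : g ≠ 0) :
    P.negOrd f < P.negOrd g ↔ P.val f < P.val g := by
  rw [P.val_eq_exp hf, P.val_eq_exp hg, WithZero.exp_lt_exp]

theorem Place.negOrd_one : P.negOrd 1 = 0 := by simp [Place.negOrd]

theorem Place.negOrd_mul {f g : F} (hf : f ≠ 0) (hg : g ≠ 0) :
    P.negOrd (f * g) = P.negOrd f + P.negOrd g := by
  rw [Place.negOrd, map_mul, P.val_eq_exp hf, P.val_eq_exp hg, ← WithZero.exp_add,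
    WithZero.log_exp]

theorem Place.negOrd_pow {f : F} (hf : f ≠ 0) (n : ℕ) : P.negOrd (f ^ n) = n * P.negOrd f := by
  induction n with
  | zero => simp [P.negOrd_one]
  | succ n ih => rw [pow_succ, P.negOrd_mul (pow_ne_zero _ hf) hf, ih]; push_cast; ring

theorem Place.negOrd_prod {ι : Type*} (s : Finset ι) (f : ι → F) (hf : ∀ i ∈ s, f i ≠ 0) :
    P.negOrd (∏ i ∈ s, f i) = ∑ i ∈ s, P.negOrd (f i) := by
  classical
  induction s using Finset.induction_on with
  | empty => simp [P.negOrd_one]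
  | insert i s hi ih =>
    rw [Finset.prod_insert hi, Finset.sum_insert hi, P.negOrd_mul (hf _ (by simp))
      (Finset.prod_ne_zero_iff.2 fun j hj ↦ hf _ (by simp [hj])), ih fun j hj ↦ hf _ (by simp [hj])]

theorem Place.negOrd_le_zero_iff (f : F) : P.negOrd f ≤ 0 ↔ P.val f ≤ 1 := by
  by_cases hf : f = 0
  · simp [hf, Place.negOrd]
  · rw [← P.negOrd_one, P.negOrd_le_negOrd hf one_ne_zero, map_one]

theorem Place.negOrd_lt_zero_iff {f : F} (hf : f ≠ 0) : P.negOrd f < 0 ↔ P.val f < 1 := by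
  rw [← P.negOrd_one, P.negOrd_lt_negOrd hf one_ne_zero, map_one]

theorem Place.val_const_mul {c : K} (hc : c ≠ 0) (f : F) :
    P.val (algebraMap K F c * f) = P.val f := by
  rw [map_mul, P.trivial_on_const c hc, one_mul]

theorem Place.val_eq_one_of_isAlgebraic {f : F} (hf : f ≠ 0) (hfa : IsAlgebraic K f) :
    P.val f = 1 := by
  have h1 := P.val.le_one_of_isIntegral P.val_algebraMap_le hfa.isIntegral
  have h2 := P.val.le_one_of_isIntegral P.val_algebraMap_le hfa.inv.isIntegral
  rw [map_inv₀, inv_le_one₀ (by rw [Valuation.pos_iff]; exact hf)] at h2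
  exact le_antisymm h1 h2

variable {P}

/-- Degree one lets a constant cancel the leading coefficient: apply it to `f / g`. -/
theorem Place.IsRational.exists_val_sub_lt (hP : P.IsRational) {f g : F} (hg : g ≠ 0)
    (h : P.val f ≤ P.val g) : ∃ c : K, P.val (f - algebraMap K F c * g) < P.val g := by
  have hg' : 0 < P.val g := by rw [Valuation.pos_iff]; exact hg
  obtain ⟨c, hc⟩ := hP (f / g) (by rw [map_div₀]; exact div_le_one_of_le₀ h zero_le)
  refine ⟨c, ?_⟩
  have : f - algebraMap K F c * g = (f / g - algebraMap K F c) * g := by field_simp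
  rw [this, map_mul]
  exact mul_lt_of_lt_one_left hg' hc

theorem Place.IsRational.eval_eq_iff (hP : P.IsRational) {f : F} (hf : P.val f ≤ 1) (c : K) :
    P.eval f = c ↔ P.val (f - algebraMap K F c) < 1 := by
  have h := hP f hf
  have he : P.val (f - algebraMap K F (P.eval f)) < 1 := by
    rw [Place.eval, dif_pos h]; exact h.choose_spec
  refine ⟨fun h ↦ h ▸ he, fun hc ↦ ?_⟩
  by_contra hne
  have h1 := P.val.map_sub_lt he hc
  rw [sub_sub_sub_cancel_left, ← map_sub, P.trivial_on_const _ (sub_ne_zero.2 (Ne.symm hne))] at h1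
  exact lt_irrefl _ h1

end Place

/-- The ring `𝓛(∞Q)` of functions that are regular away from `Q`. -/
def regularAway (Q : Place K F) : Subalgebra K F where
  carrier := {f | ∀ P : Place K F, P ≠ Q → P.val f ≤ 1}
  mul_mem' {f g} hf hg P hP := by
    rw [map_mul]; exact mul_le_one₀ (hf P hP) zero_le (hg P hP)
  add_mem' {f g} hf hg P hP := (P.val.map_add f g).trans (max_le (hf P hP) (hg P hP))
  algebraMap_mem' c P _ := P.val_algebraMap_le c

variable {Q : Place K F}

theorem mem_regularAway {f : F} : f ∈ regularAway Q ↔ ∀ P : Place K F, P ≠ Q → P.val f ≤ 1 :=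
  Iff.rfl

theorem mem_rrSpace_single {f : F} {u : ℤ} :
    f ∈ rrSpace (Finsupp.single Q u) ↔ f = 0 ∨ (f ∈ regularAway Q ∧ Q.negOrd f ≤ u) := by
  classical
  refine or_congr_right ⟨fun h ↦ ⟨fun P hP ↦ ?_, by simpa using h Q⟩, fun ⟨h1, h2⟩ P ↦ ?_⟩
  · have := h P
    rw [Finsupp.single_eq_of_ne hP] at this
    exact (P.negOrd_le_zero_iff f).1 this
  · by_cases hP : P = Q
    · subst hP; simpa using h2
    · rw [Finsupp.single_eq_of_ne hP]
      exact (P.negOrd_le_zero_iff f).2 (h1 P hP)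

theorem mem_idealSpace {n : ℕ} {P : Fin n → Place K F} (hPinj : Function.Injective P)
    (hPQ : ∀ k, P k ≠ Q) {f : F} :
    f ∈ idealSpace Q P ↔ f ∈ regularAway Q ∧ ∀ k, (P k).val f < 1 := by
  classical
  by_cases hf : f = 0
  · subst hf
    simp only [map_zero, zero_mem, true_and, zero_lt_one, implies_true, iff_true]
    exact Set.mem_iUnion.2 ⟨0, Or.inl rfl⟩
  have hD (P' : Place K F) :
      (∑ k, Finsupp.single (P k) (1 : ℤ)) P' = if ∃ k, P k = P' then 1 else 0 := by
    rw [Finsupp.finsetSum_apply]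
    simp only [Finsupp.single_apply]
    split_ifs with h
    · obtain ⟨k, rfl⟩ := h
      simp [hPinj.eq_iff]
    · push Not at h
      simp [h]
  simp only [idealSpace, Set.mem_iUnion, rrSpace, Set.mem_ofPred_eq, hf, false_or,
    Finsupp.sub_apply, hD]
  constructor
  · rintro ⟨i, h⟩
    refine ⟨fun P' hP' ↦ ?_, fun k ↦ ?_⟩
    · have := h P'
      rw [Finsupp.single_eq_of_ne hP'] at this
      refine (P'.negOrd_le_zero_iff f).1 (this.trans ?_)
      split_ifs <;> simp
    · have := h (P k)
      rw [Finsupp.single_eq_of_ne (hPQ k), if_pos ⟨k, rfl⟩] at this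
      exact ((P k).negOrd_lt_zero_iff hf).1 (by omega)
  · rintro ⟨h1, h2⟩
    refine ⟨(Q.negOrd f).toNat, fun P' ↦ ?_⟩
    by_cases hP' : P' = Q
    · subst hP'
      rw [if_neg (by simpa using hPQ)]
      simp
    · rw [Finsupp.single_eq_of_ne hP']
      split_ifs with h
      · obtain ⟨k, rfl⟩ := h
        have := ((P k).negOrd_lt_zero_iff hf).2 (h2 k)
        omega
      · simpa using (P'.negOrd_le_zero_iff f).2 (h1 P' hP')

section FunctionField

variable [Algebra (RatFunc K) F] [IsScalarTower K (RatFunc K) F] [FunctionField K F]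

/-- A transcendental function has a pole somewhere, and here `Q` is the only candidate; algebraic
ones have value `1`. -/
theorem negOrd_nonneg {f : F} (hf : f ∈ regularAway Q) (hf0 : f ≠ 0) : 0 ≤ Q.negOrd f := by
  by_cases hfa : IsAlgebraic K f
  · simp [Place.negOrd, Q.val_eq_one_of_isAlgebraic hf0 hfa]
  · obtain ⟨P, hP⟩ := exists_place_one_lt hfa
    have hPQ : P = Q := by
      by_contra h
      exact hP.not_ge (hf P h)
    subst hPQ
    rw [← not_lt, P.negOrd_lt_zero_iff hf0]
    exact hP.not_gt

theorem mem_weierstrass {m : ℕ} :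
    m ∈ weierstrass Q ↔ ∃ f ∈ regularAway Q, f ≠ 0 ∧ Q.negOrd f = m := by
  classical
  constructor
  · rintro ⟨f, hf0, hf⟩
    have hR : f ∈ regularAway Q := fun P hP ↦ by
      have := hf P
      rw [Finsupp.single_eq_of_ne hP] at this
      exact (P.negOrd_le_zero_iff f).1 (by omega)
    refine ⟨f, hR, hf0, ?_⟩
    have := negOrd_nonneg hR hf0
    have := hf Q
    rw [Finsupp.single_eq_same] at this
    omega
  · rintro ⟨f, hR, hf0, hf⟩
    refine ⟨f, hf0, fun P ↦ ?_⟩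
    by_cases hP : P = Q
    · subst hP; simp [hf]
    · rw [Finsupp.single_eq_of_ne hP]
      exact max_eq_right ((P.negOrd_le_zero_iff f).2 (hR P hP))

theorem toNat_negOrd_mem_weierstrass {f : F} (hf : f ∈ regularAway Q) (hf0 : f ≠ 0) :
    (Q.negOrd f).toNat ∈ weierstrass Q :=
  mem_weierstrass.2 ⟨f, hf, hf0, (Int.toNat_of_nonneg (negOrd_nonneg hf hf0)).symm⟩

/-- Take `p` with a simple pole at `Q` and clear denominators by some `g ∈ K[x]` so that `g p` is
integral over `K[x]`. Then `g` and `g p` lie in `𝓛(∞Q)` and have consecutive pole orders `q`, `q +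
1`. -/
theorem exists_mem_weierstrass_modEq {a : ℕ} (ha : 0 < a) (haQ : a ∈ weierstrass Q) (i : ℕ) :
    ∃ m ∈ weierstrass Q, m ≡ i [MOD a] := by
  obtain ⟨x, hx, hx0, hxa⟩ := mem_weierstrass.1 haQ
  have hxt : Transcendental K x := fun h ↦ by
    have := Q.val_eq_one_of_isAlgebraic hx0 h
    rw [Place.negOrd, this, WithZero.log_one] at hxa
    omega
  obtain ⟨p, hp⟩ := Q.surjective (WithZero.exp 1)
  have hp0 : p ≠ 0 := by rintro rfl; exact WithZero.exp_ne_zero (hp.symm.trans (map_zero _))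
  obtain ⟨g, hg0, hg⟩ :=
    ((FunctionField.isAlgebraic_adjoin_singleton hxt).isAlgebraic p).exists_integral_multiple
  have hsub : ∀ r : Algebra.adjoin K {x}, (r : F) ∈ regularAway Q := fun r ↦
    Algebra.adjoin_le (Set.singleton_subset_iff.2 hx) r.2
  have hgF : (g : F) ≠ 0 := by simpa using hg0
  have hgp : (g : F) * p ∈ regularAway Q := fun P hP ↦
    P.val.le_one_of_isIntegral (fun r ↦ hsub r P hP) hg
  have hgR := hsub g
  have h1 : Q.negOrd ((g : F) * p) = Q.negOrd (g : F) + 1 := by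
    rw [Q.negOrd_mul hgF hp0]
    simp [Place.negOrd, hp]
  obtain ⟨q, hq⟩ := Int.eq_ofNat_of_zero_le (negOrd_nonneg hgR hgF)
  obtain ⟨a, rfl⟩ := Nat.exists_eq_succ_of_ne_zero ha.ne'
  -- With the modulus rewritten as `a + 1`, the pole order is `i (q + 1) + i a q = i + (a + 1) i q`.
  refine ⟨i + a.succ * (i * q), mem_weierstrass.2 ⟨((g : F) * p) ^ i * (g : F) ^ (i * a),
    mul_mem (pow_mem hgp _) (pow_mem hgR _), ?_, ?_⟩, ?_⟩
  · simp [hgF, hp0]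
  · rw [Q.negOrd_mul (by simp [hgF, hp0]) (by simp [hgF]), Q.negOrd_pow (by simp [hgF, hp0]),
      Q.negOrd_pow hgF, h1, hq]
    push_cast
    ring
  · simp [Nat.ModEq]

end FunctionField

end OnePointCode

/-! ### The monomials `x₁ ^ j y_i` and their pole orders. -/

namespace OnePointCode

section Prec

variable {t : ℕ}

theorem exists_prec_least (a : Fin t → ℕ) (ha : ∀ i, 0 < a i) {b : ℕ}
    (hb : ∃ m, weight a m = b) :
    ∃ m, weight a m = b ∧ ∀ m', weight a m' = b → m' ≠ m → Prec a m m' := by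
  have hfin : {m | weight a m = b}.Finite := by
    refine (Set.finite_Iic (fun _ : Fin t ↦ b)).subset fun m hm k ↦ ?_
    calc m k ≤ a k * m k := Nat.le_mul_of_pos_left _ (ha k)
      _ ≤ weight a m := Finset.single_le_sum (f := fun k ↦ a k * m k) (fun _ _ ↦ Nat.zero_le _)
        (Finset.mem_univ k)
      _ = b := hm
  -- Ties in `≺` are broken by reversed lexicographic order, so the `≺`-least vector is the
  -- lexicographically greatest.
  obtain ⟨m, hm, hmax⟩ := hfin.exists_maximalFor toLex _ hb
  refine ⟨m, hm, fun m' hm' hne ↦ Or.inr ⟨hm.trans hm'.symm, ?_⟩⟩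
  have hlt : toLex m' < toLex m := by
    rcases lt_trichotomy (toLex m') (toLex m) with h | h | h
    · exact h
    · exact absurd h hne
    · exact absurd (hmax hm' h.le) h.not_ge
  obtain ⟨i, h1, h2⟩ := hlt
  exact ⟨i, fun k hk ↦ (h1 k hk).symm, h2⟩

end Prec

variable {K F : Type*} [Field K] [Field F] [Algebra K F] {t : ℕ}

theorem Place.IsRational.exists_eq_const_mul_add {Q : Place K F} (hQ : Q.IsRational) {f g : F} (hf : f ∈ regularAway Q)
    (hg : g ∈ regularAway Q) (hf0 : f ≠ 0) (hg0 : g ≠ 0) (h : Q.negOrd f = Q.negOrd g) :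
    ∃ c : K, c ≠ 0 ∧ ∃ r ∈ regularAway Q, f = algebraMap K F c * g + r ∧
      (r = 0 ∨ Q.negOrd r < Q.negOrd f) := by
  obtain ⟨c, hc⟩ := hQ.exists_val_sub_lt hg0 ((Q.negOrd_le_negOrd hf0 hg0).1 h.le)
  refine ⟨c, ?_, f - algebraMap K F c * g,
    sub_mem hf (mul_mem (Subalgebra.algebraMap_mem _ _) hg), by ring, ?_⟩
  · rintro rfl
    rw [map_zero, zero_mul, sub_zero] at hc
    exact hc.not_ge ((Q.negOrd_le_negOrd hg0 hf0).1 h.ge)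
  · by_cases h0 : f - algebraMap K F c * g = 0
    · exact Or.inl h0
    · rw [h]
      exact Or.inr ((Q.negOrd_lt_negOrd h0 hg0).2 hc)

/-- The numbers `a` generate the Weierstrass semigroup of `Q`, and the functions `x` have the
corresponding pole divisors. -/
structure IsGenerating (Q : Place K F) (a : Fin t → ℕ) (x : Fin t → F) : Prop where
  pos : ∀ i, 0 < a i
  closure_eq : (AddSubmonoid.closure (Set.range a) : Set ℕ) = weierstrass Q
  hasPoleDivisor : ∀ i, HasPoleDivisor (x i) (Finsupp.single Q (a i : ℤ))

namespace IsGenerating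

variable {Q : Place K F} {a : Fin t → ℕ} {x : Fin t → F}

theorem add_mem (hg : IsGenerating Q a x) {m m' : ℕ} (hm : m ∈ weierstrass Q) (hm' : m' ∈ weierstrass Q) :
    m + m' ∈ weierstrass Q := by
  rw [← hg.closure_eq] at *
  exact AddSubmonoid.add_mem _ hm hm'

theorem mul_mem (hg : IsGenerating Q a x) {m : ℕ} (hm : m ∈ weierstrass Q) (k : ℕ) : m * k ∈ weierstrass Q := by
  rw [← hg.closure_eq] at *
  rw [mul_comm]
  exact AddSubmonoid.nsmul_mem _ hm k

theorem zero_mem (hg : IsGenerating Q a x) : 0 ∈ weierstrass Q := by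
  rw [← hg.closure_eq]
  exact AddSubmonoid.zero_mem _

theorem generator_mem (hg : IsGenerating Q a x) (i : Fin t) : a i ∈ weierstrass Q := by
  rw [← hg.closure_eq]
  exact AddSubmonoid.subset_closure ⟨i, rfl⟩

theorem weight_mem (hg : IsGenerating Q a x) (m : Fin t → ℕ) : weight a m ∈ weierstrass Q := by
  have h (k) : a k * m k ∈ weierstrass Q := hg.mul_mem (hg.generator_mem k) _
  rw [← hg.closure_eq] at *
  exact AddSubmonoid.sum_mem _ fun k _ ↦ h k

theorem exists_weight_eq (hg : IsGenerating Q a x) {s : ℕ} (hs : s ∈ weierstrass Q) : ∃ m, weight a m = s := by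
  rw [← hg.closure_eq] at hs
  induction hs using AddSubmonoid.closure_induction with
  | mem s hs =>
    obtain ⟨i, rfl⟩ := hs
    exact ⟨Pi.single i 1, by simp [weight, Pi.single_apply]⟩
  | zero => exact ⟨0, by simp [weight]⟩
  | add r s _ _ hr hs =>
    obtain ⟨m, rfl⟩ := hr
    obtain ⟨m', rfl⟩ := hs
    exact ⟨m + m', by simp [weight, mul_add, Finset.sum_add_distrib]⟩

theorem ne_zero (hg : IsGenerating Q a x) (i : Fin t) : x i ≠ 0 := (hg.hasPoleDivisor i).1

theorem mem_regularAway (hg : IsGenerating Q a x) (i : Fin t) : x i ∈ regularAway Q := fun P hP ↦ by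
  classical
  have := (hg.hasPoleDivisor i).2 P
  rw [Finsupp.single_eq_of_ne hP] at this
  exact (P.negOrd_le_zero_iff _).1 (by omega)

theorem negOrd_generator (hg : IsGenerating Q a x) (i : Fin t) : Q.negOrd (x i) = a i := by
  classical
  have := (hg.hasPoleDivisor i).2 Q
  rw [Finsupp.single_eq_same] at this
  have := hg.pos i
  omega

variable [NeZero t]

theorem y_ne_zero (hg : IsGenerating Q a x) (i : ℕ) : y Q a x i ≠ 0 :=
  Finset.prod_ne_zero_iff.2 fun k _ ↦ pow_ne_zero _ (hg.ne_zero k)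

theorem y_mem_regularAway (hg : IsGenerating Q a x) (i : ℕ) : y Q a x i ∈ regularAway Q :=
  Subalgebra.prod_mem _ fun k _ ↦ pow_mem (hg.mem_regularAway k) _

theorem monomial_ne_zero (hg : IsGenerating Q a x) (j i : ℕ) : x 0 ^ j * y Q a x i ≠ 0 :=
  mul_ne_zero (pow_ne_zero _ (hg.ne_zero 0)) (hg.y_ne_zero i)

theorem monomial_mem_regularAway (hg : IsGenerating Q a x) (j i : ℕ) : x 0 ^ j * y Q a x i ∈ regularAway Q :=
  Subalgebra.mul_mem _ (pow_mem (hg.mem_regularAway 0) _) (hg.y_mem_regularAway i)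

theorem apery_le {i m : ℕ} (hm : m ∈ weierstrass Q) (hmi : m ≡ i [MOD a 0]) : apery Q a i ≤ m :=
  Nat.sInf_le ⟨hm, hmi⟩

section FunctionField

variable [Algebra (RatFunc K) F] [IsScalarTower K (RatFunc K) F] [FunctionField K F]

theorem apery_spec (hg : IsGenerating Q a x) (i : ℕ) : apery Q a i ∈ weierstrass Q ∧ apery Q a i ≡ i [MOD a 0] :=
  Nat.sInf_mem (exists_mem_weierstrass_modEq (hg.pos 0) (hg.generator_mem 0) i)

theorem mem_weierstrass_iff (hg : IsGenerating Q a x) {m : ℕ} : m ∈ weierstrass Q ↔ apery Q a (m % a 0) ≤ m := by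
  refine ⟨fun h ↦ apery_le h (Nat.mod_modEq _ _).symm, fun h ↦ ?_⟩
  obtain ⟨h1, h2⟩ := hg.apery_spec (m % a 0)
  obtain ⟨k, hk⟩ := (Nat.modEq_iff_dvd' h).1 (h2.trans (Nat.mod_modEq _ _))
  rw [← Nat.sub_add_cancel h, hk]
  exact hg.add_mem (hg.mul_mem (hg.generator_mem 0) k) h1

theorem weight_aperyExp (hg : IsGenerating Q a x) (i : ℕ) : weight a (aperyExp Q a i) = apery Q a i := by
  have h := exists_prec_least a hg.pos (hg.exists_weight_eq (hg.apery_spec i).1)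
  rw [aperyExp, dif_pos h]
  exact h.choose_spec.1

/-- Otherwise lowering this exponent by one would give an element of `H(Q)` in the same class,
smaller than `b_i`. -/
theorem aperyExp_zero (hg : IsGenerating Q a x) (i : ℕ) : aperyExp Q a i 0 = 0 := by
  by_contra h
  obtain ⟨c, hc⟩ := Nat.exists_eq_succ_of_ne_zero h
  have h1 : weight a (Function.update (aperyExp Q a i) 0 c) + a 0 = apery Q a i := by
    rw [← hg.weight_aperyExp, weight, weight, ← Finset.add_sum_erase _ _ (Finset.mem_univ 0),
      ← Finset.add_sum_erase _ _ (Finset.mem_univ (0 : Fin t)), hc]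
    have : ∑ k ∈ Finset.univ.erase 0, a k * Function.update (aperyExp Q a i) 0 c k =
        ∑ k ∈ Finset.univ.erase 0, a k * aperyExp Q a i k :=
      Finset.sum_congr rfl fun k hk ↦ by rw [Function.update_of_ne (Finset.ne_of_mem_erase hk)]
    rw [this, Function.update_self, Nat.mul_succ]
    omega
  have h2 := apery_le (a := a) (i := i) (hg.weight_mem (Function.update (aperyExp Q a i) 0 c))
    (((Nat.add_modEq_right (n := a 0)).symm.trans (by rw [h1])).trans (hg.apery_spec i).2)
  have := hg.pos 0
  omega

theorem weight_monoExp (hg : IsGenerating Q a x) (p : ℕ × ℕ) :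
    weight a (monoExp Q a p) = a 0 * p.1 + apery Q a p.2 := by
  rw [← hg.weight_aperyExp, weight, weight, ← Finset.add_sum_erase _ _ (Finset.mem_univ 0),
      ← Finset.add_sum_erase _ _ (Finset.mem_univ (0 : Fin t)), hg.aperyExp_zero, mul_zero,
      zero_add]
  congr 1
  exact Finset.sum_congr rfl fun k hk ↦ by rw [monoExp, if_neg (Finset.ne_of_mem_erase hk)]

theorem negOrd_y (hg : IsGenerating Q a x) (i : ℕ) : Q.negOrd (y Q a x i) = apery Q a i := by
  rw [y, Q.negOrd_prod _ _ fun k _ ↦ pow_ne_zero _ (hg.ne_zero k), ← hg.weight_aperyExp, weight,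
    ← Finset.add_sum_erase _ _ (Finset.mem_univ (0 : Fin t)), hg.aperyExp_zero, mul_zero, zero_add]
  push_cast
  exact Finset.sum_congr rfl fun k _ ↦ by
    rw [Q.negOrd_pow (hg.ne_zero k), hg.negOrd_generator, mul_comm]

theorem negOrd_monomial (hg : IsGenerating Q a x) (j i : ℕ) :
    Q.negOrd (x 0 ^ j * y Q a x i) = ((a 0 * j + apery Q a i : ℕ) : ℤ) := by
  rw [Q.negOrd_mul (pow_ne_zero _ (hg.ne_zero 0)) (hg.y_ne_zero i), Q.negOrd_pow (hg.ne_zero 0),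
    hg.negOrd_generator, hg.negOrd_y]
  push_cast
  ring

theorem degree_injective (hg : IsGenerating Q a x) {p r : ℕ × ℕ} (hp : p.2 < a 0) (hr : r.2 < a 0)
    (h : a 0 * p.1 + apery Q a p.2 = a 0 * r.1 + apery Q a r.2) : p = r := by
  have h2 : p.2 = r.2 := by
    refine Nat.ModEq.eq_of_lt_of_lt (m := a 0) ?_ hp hr
    refine ((hg.apery_spec p.2).2.symm.trans ?_).trans (hg.apery_spec r.2).2
    have := congrArg (· % a 0) h
    simpa [Nat.ModEq] using this
  rw [h2, Nat.add_right_cancel_iff, Nat.mul_right_inj (hg.pos 0).ne'] at h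
  exact Prod.ext h h2

theorem exists_degree_eq (hg : IsGenerating Q a x) {s : ℕ} (hs : s ∈ weierstrass Q) :
    ∃ j, s = a 0 * j + apery Q a (s % a 0) := by
  have h := hg.mem_weierstrass_iff.1 hs
  obtain ⟨k, hk⟩ := (Nat.modEq_iff_dvd' h).1 ((hg.apery_spec _).2.trans (Nat.mod_modEq _ _))
  exact ⟨k, by omega⟩

/-- The tie-breaking clause of `≺` never acts between distinct basis monomials. -/
theorem weight_lt_of_prec (hg : IsGenerating Q a x) {p r : ℕ × ℕ} (hp : p.2 < a 0) (hr : r.2 < a 0) (hne : r ≠ p)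
    (h : Prec a (monoExp Q a r) (monoExp Q a p)) :
    a 0 * r.1 + apery Q a r.2 < a 0 * p.1 + apery Q a p.2 := by
  rw [Prec, hg.weight_monoExp, hg.weight_monoExp] at h
  exact h.elim id fun h ↦ absurd (hg.degree_injective hr hp h.1) hne

theorem of_hasLeadingMonomial (hg : IsGenerating Q a x) {f : F} {p : ℕ × ℕ} (h : HasLeadingMonomial Q a x f p) :
    p.2 < a 0 ∧ f ∈ regularAway Q ∧ f ≠ 0 ∧
      Q.negOrd f = ((a 0 * p.1 + apery Q a p.2 : ℕ) : ℤ) := by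
  classical
  obtain ⟨c, hc, rfl, hp, hlt⟩ := h
  have hv (r) (hr : r ∈ c.support) :
      Q.val (algebraMap K F (c r) * (x 0 ^ r.1 * y Q a x r.2)) =
        WithZero.exp ((a 0 * r.1 + apery Q a r.2 : ℕ) : ℤ) := by
    rw [Q.val_const_mul (Finsupp.mem_support_iff.1 hr), Q.val_eq_exp (hg.monomial_ne_zero _ _),
      hg.negOrd_monomial]
  have hval : Q.val (c.sum fun r k ↦ algebraMap K F k * (x 0 ^ r.1 * y Q a x r.2)) =
      WithZero.exp ((a 0 * p.1 + apery Q a p.2 : ℕ) : ℤ) := by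
    rw [Finsupp.sum, ← hv p hp]
    refine Q.val.map_sum_eq_of_lt
      (f := fun r ↦ algebraMap K F (c r) * (x 0 ^ r.1 * y Q a x r.2)) hp fun r hr ↦ ?_
    rw [Finset.mem_sdiff, Finset.mem_singleton] at hr
    rw [hv r hr.1, hv p hp, WithZero.exp_lt_exp]
    exact_mod_cast hg.weight_lt_of_prec (hc p hp) (hc r hr.1) hr.2 (hlt r hr.1 hr.2)
  refine ⟨hc p hp, Subalgebra.sum_mem _ fun r _ ↦ Subalgebra.mul_mem _ (Subalgebra.algebraMap_mem _ _)
    (hg.monomial_mem_regularAway _ _), ?_, by rw [Place.negOrd, hval, WithZero.log_exp]⟩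
  rintro h0
  rw [h0, map_zero] at hval
  exact WithZero.exp_ne_zero hval.symm

/-- Subtracting a constant multiple of the monomial of equal pole order leaves a remainder of
smaller pole order, expanded by induction. Together with `of_hasLeadingMonomial`, the leading
monomial and the pole order determine each other. -/
theorem hasLeadingMonomial_of_negOrd (hg : IsGenerating Q a x) (hQ : Q.IsRational) {f : F} (hf : f ∈ regularAway Q)
    (hf0 : f ≠ 0) {p : ℕ × ℕ} (hp : p.2 < a 0)
    (h : Q.negOrd f = ((a 0 * p.1 + apery Q a p.2 : ℕ) : ℤ)) : HasLeadingMonomial Q a x f p := by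
  classical
  induction hd : a 0 * p.1 + apery Q a p.2 using Nat.strong_induction_on generalizing f p with
  | _ d ih =>
  obtain ⟨k, hk0, r, hr, hfr, hlt⟩ := hQ.exists_eq_const_mul_add hf
    (hg.monomial_mem_regularAway p.1 p.2) hf0 (hg.monomial_ne_zero p.1 p.2)
    (h.trans (hg.negOrd_monomial _ _).symm)
  by_cases hr0 : r = 0
  · subst hr0
    refine ⟨Finsupp.single p k, fun q hq ↦ ?_, ?_, ?_, fun q hq hqp ↦ ?_⟩
    · exact Finset.mem_singleton.1 (Finsupp.support_single_subset hq) ▸ hp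
    · rw [Finsupp.sum_single_index (by simp), hfr, add_zero]
    · simpa using hk0
    · exact absurd (Finset.mem_singleton.1 (Finsupp.support_single_subset hq)) hqp
  have hlt := hlt.resolve_left hr0
  have hrH := toNat_negOrd_mem_weierstrass hr hr0
  have hrn := Int.toNat_of_nonneg (negOrd_nonneg hr hr0)
  obtain ⟨j, hj⟩ := hg.exists_degree_eq hrH
  obtain ⟨c, hc, hsum, hq, hmax⟩ := ih (Q.negOrd r).toNat (by omega) hr hr0
    (p := (j, (Q.negOrd r).toNat % a 0)) (Nat.mod_lt _ (hg.pos 0)) (by simp only; omega) hj.symm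
  have hw (q) (hqc : q ∈ c.support) : a 0 * q.1 + apery Q a q.2 < d := by
    by_cases hqe : q = (j, (Q.negOrd r).toNat % a 0)
    · subst hqe; simp only; omega
    · have := hg.weight_lt_of_prec (hc _ hq) (hc q hqc) hqe (hmax q hqc hqe)
      simp only at this
      omega
  have hpc : p ∉ c.support := fun hpc ↦ (hw p hpc).ne hd
  have hcp : c p = 0 := by simpa using hpc
  refine ⟨c + Finsupp.single p k, fun q hq ↦ ?_, ?_, ?_, fun q hq hqp ↦ ?_⟩
  · by_cases hqp : q = p
    · exact hqp ▸ hp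
    · exact hc q (by simpa [Finsupp.single_eq_of_ne hqp] using hq)
  · rw [Finsupp.sum_add_index' (by simp) (by intros; rw [map_add, add_mul]),
      Finsupp.sum_single_index (by simp), ← hsum, add_comm, hfr]
  · simpa [hcp] using hk0
  · refine Or.inl ?_
    rw [hg.weight_monoExp, hg.weight_monoExp, hd]
    exact hw q (by simpa [Finsupp.single_eq_of_ne hqp] using hq)

end FunctionField

end IsGenerating

end OnePointCode

/-! ### The evaluation map and the jumps of the codes `C_u`. -/

namespace OnePointCode

variable {K F : Type*} [Field K] [Field F] [Algebra K F]

section Evaluation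

variable {Q : Place K F} {n : ℕ} {P : Fin n → Place K F}

theorem ev_add (hP : ∀ k, (P k).IsRational) (hPQ : ∀ k, P k ≠ Q) {f g : F}
    (hf : f ∈ regularAway Q) (hg : g ∈ regularAway Q) : ev P (f + g) = ev P f + ev P g := by
  funext k
  have hf' := hf _ (hPQ k)
  have hg' := hg _ (hPQ k)
  refine ((hP k).eval_eq_iff (add_mem hf hg _ (hPQ k)) _).2 ?_
  have h1 := ((hP k).eval_eq_iff hf' _).1 rfl
  have h2 := ((hP k).eval_eq_iff hg' _).1 rfl
  have : f + g - algebraMap K F ((ev P f + ev P g) k) =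
      (f - algebraMap K F ((P k).eval f)) + (g - algebraMap K F ((P k).eval g)) := by
    simp only [Pi.add_apply, ev, map_add]; ring
  rw [this]
  exact (P k).val.map_add_lt h1 h2

theorem ev_const_mul (hP : ∀ k, (P k).IsRational) (hPQ : ∀ k, P k ≠ Q) (c : K) {f : F}
    (hf : f ∈ regularAway Q) : ev P (algebraMap K F c * f) = c • ev P f := by
  funext k
  have hf' := hf _ (hPQ k)
  have hc := (P k).val_algebraMap_le c
  refine ((hP k).eval_eq_iff (mul_mem (Subalgebra.algebraMap_mem _ c) hf _ (hPQ k)) _).2 ?_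
  have h1 := ((hP k).eval_eq_iff hf' _).1 rfl
  have : algebraMap K F c * f - algebraMap K F ((c • ev P f) k) =
      algebraMap K F c * (f - algebraMap K F ((P k).eval f)) := by
    simp only [Pi.smul_apply, smul_eq_mul, ev, map_mul]; ring
  rw [this, map_mul]
  exact mul_lt_one_of_nonneg_of_lt_one_right hc zero_le h1

theorem ev_eq_zero_iff (hP : ∀ k, (P k).IsRational) (hPQ : ∀ k, P k ≠ Q)
    {f : F} (hf : f ∈ regularAway Q) : ev P f = 0 ↔ ∀ k, (P k).val f < 1 := by
  rw [funext_iff]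
  refine forall_congr' fun k ↦ ?_
  refine ((hP k).eval_eq_iff (hf _ (hPQ k)) _).trans ?_
  simp

theorem ev_one (hP : ∀ k, (P k).IsRational) : ev P (1 : F) = 1 := by
  funext k
  exact ((hP k).eval_eq_iff (by simp) _).2 (by simp)

theorem mem_idealSpace_iff_ev (hPinj : Function.Injective P) (hP : ∀ k, (P k).IsRational)
    (hPQ : ∀ k, P k ≠ Q) {f : F} : f ∈ idealSpace Q P ↔ f ∈ regularAway Q ∧ ev P f = 0 := by
  rw [mem_idealSpace hPinj hPQ]
  exact and_congr_right fun hf ↦ (ev_eq_zero_iff hP hPQ hf).symm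

theorem ev_zero (hP : ∀ k, (P k).IsRational) (hPQ : ∀ k, P k ≠ Q) : ev P (0 : F) = 0 :=
  (ev_eq_zero_iff hP hPQ (Subalgebra.zero_mem _)).2 (by simp)

theorem code_mono {u v : ℤ} (h : u ≤ v) : code Q P u ⊆ code Q P v :=
  Set.image_mono fun _ hf ↦ mem_rrSpace_single.2
    ((mem_rrSpace_single.1 hf).imp_right fun hf ↦ ⟨hf.1, hf.2.trans h⟩)

section FunctionField

variable [Algebra (RatFunc K) F] [IsScalarTower K (RatFunc K) F] [FunctionField K F]

theorem code_neg_one (hP : ∀ k, (P k).IsRational) (hPQ : ∀ k, P k ≠ Q) :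
    code Q P (-1) = {0} := by
  have : rrSpace (Finsupp.single Q (-1)) = {0} := by
    ext f
    rw [mem_rrSpace_single, Set.mem_singleton_iff]
    refine ⟨fun h ↦ ?_, Or.inl⟩
    by_contra h0
    obtain ⟨h1, h2⟩ := h.resolve_left h0
    have := negOrd_nonneg h1 h0
    omega
  rw [code, this, Set.image_singleton, ev_zero hP hPQ]

/-- If the codes agree, a function of pole order `u` differs from one of smaller order by an element
of the kernel of `ev`. Conversely, a kernel element of order `u` can be used to lower the order of
any function without changing its image. -/
theorem code_eq_code_sub_one_iff (hPinj : Function.Injective P) (hQ : Q.IsRational)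
    (hP : ∀ k, (P k).IsRational) (hPQ : ∀ k, P k ≠ Q) {u : ℕ} (hu : u ∈ weierstrass Q) :
    code Q P u = code Q P (u - 1) ↔ ∃ f ∈ idealSpace Q P, f ≠ 0 ∧ Q.negOrd f = u := by
  constructor
  · intro h
    obtain ⟨f, hf, hf0, hfu⟩ := mem_weierstrass.1 hu
    have : ev P f ∈ code Q P (u - 1) := by
      rw [← h]; exact ⟨f, mem_rrSpace_single.2 (Or.inr ⟨hf, hfu.le⟩), rfl⟩
    obtain ⟨g, hg, hgf⟩ := this
    rw [mem_rrSpace_single] at hg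
    have hgR : g ∈ regularAway Q := hg.elim (fun h ↦ h ▸ Subalgebra.zero_mem _) And.left
    have hlt : Q.val g < Q.val f := by
      by_cases hg0 : g = 0
      · rw [hg0, map_zero, Valuation.pos_iff]; exact hf0
      · have := (hg.resolve_left hg0).2
        exact (Q.negOrd_lt_negOrd hg0 hf0).1 (by omega)
    have hval := Q.val.map_sub_eq_of_lt_left hlt
    refine ⟨f - g, (mem_idealSpace_iff_ev hPinj hP hPQ).2 ⟨sub_mem hf hgR, ?_⟩, ?_, ?_⟩
    · have h1 := ev_add hP hPQ (sub_mem hf hgR) hgR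
      rw [sub_add_cancel, hgf] at h1
      exact right_eq_add.1 h1
    · intro h0
      rw [sub_eq_zero] at h0
      exact hlt.ne (h0 ▸ rfl)
    · rw [Place.negOrd, hval]; exact hfu
  · rintro ⟨f, hf, hf0, hfu⟩
    obtain ⟨hfR, hf1⟩ := (mem_idealSpace_iff_ev hPinj hP hPQ).1 hf
    refine Set.Subset.antisymm ?_ (code_mono (by omega))
    rintro _ ⟨g, hg, rfl⟩
    rw [mem_rrSpace_single] at hg
    by_cases h0 : g = 0 ∨ Q.negOrd g < u
    · refine ⟨g, mem_rrSpace_single.2 (h0.imp_right fun h ↦ ⟨?_, by omega⟩), rfl⟩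
      exact hg.elim (fun h ↦ h ▸ Subalgebra.zero_mem _) And.left
    · push Not at h0
      obtain ⟨hgR, hgu⟩ := hg.resolve_left h0.1
      obtain ⟨c, -, r, hr, hgr, hlt⟩ := hQ.exists_eq_const_mul_add hgR hfR h0.1 hf0
        (by omega)
      refine ⟨r, mem_rrSpace_single.2 (hlt.imp_right fun h ↦ ⟨hr, by omega⟩), ?_⟩
      rw [hgr, ev_add hP hPQ (mul_mem (Subalgebra.algebraMap_mem _ c) hfR) hr,
        ev_const_mul hP hPQ c hfR, hf1, smul_zero, zero_add]

theorem zero_mem_hatH (hn : 0 < n) (hP : ∀ k, (P k).IsRational) (hPQ : ∀ k, P k ≠ Q) :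
    0 ∈ hatH Q P := by
  refine ⟨mem_weierstrass.2 ⟨1, Subalgebra.one_mem _, one_ne_zero, by simp [Q.negOrd_one]⟩,
    fun h ↦ ?_⟩
  have h1 : ev P (1 : F) ∈ code Q P ((0 : ℕ) : ℤ) :=
    ⟨1, mem_rrSpace_single.2 (Or.inr ⟨Subalgebra.one_mem _, by simp [Q.negOrd_one]⟩), rfl⟩
  rw [h, ev_one hP, Nat.cast_zero, zero_sub, code_neg_one hP hPQ, Set.mem_singleton_iff] at h1
  have := congrFun h1 ⟨0, hn⟩
  simp at this

end FunctionField

end Evaluation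

/-! ### Counting class by class. -/

section Counting

/-- The number of `j` with `b ≤ j` for the Apéry element `b` of the class of `j`, and with `j + s`
below the bound `e` for its class, computed class by class. -/
theorem finite_and_ncard_eq_sum {A : ℕ} (hA : 0 < A) {b e : ℕ → ℕ}
    (hb : ∀ i < A, b i ≡ i [MOD A]) (he : ∀ i < A, e i ≡ i [MOD A]) (s : ℕ) :
    {j | b (j % A) ≤ j ∧ j + s < e ((j + s) % A)}.Finite ∧
    1 / (A : ℝ) * ∑ i ∈ Finset.range A, ((max ((e ((i + s) % A) : ℤ) - b i - s) 0 : ℤ) : ℝ) =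
      ({j | b (j % A) ≤ j ∧ j + s < e ((j + s) % A)}.ncard : ℝ) := by
  classical
  -- Truncated subtraction plays the role of `max (·) 0`; the division is exact because `e_{i'} ≡
  -- b_i + s`.
  let N (i : ℕ) : ℕ := (e ((i + s) % A) - b i - s) / A
  have hN (i : ℕ) (hi : i < A) : A * N i = e ((i + s) % A) - b i - s := by
    refine Nat.mul_div_cancel' ?_
    rw [Nat.sub_sub]
    by_cases hle : b i + s ≤ e ((i + s) % A)
    · refine (Nat.modEq_iff_dvd' hle).1 (((hb i hi).add_right s).trans ?_)
      exact ((he _ (Nat.mod_lt _ hA)).trans (Nat.mod_modEq _ _)).symm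
    · rw [Nat.sub_eq_zero_of_le (by omega)]; exact dvd_zero _
  let T : Finset (Σ _ : ℕ, ℕ) := (Finset.range A).sigma fun i ↦ Finset.range (N i)
  let φ : (Σ _ : ℕ, ℕ) → ℕ := fun p ↦ b p.1 + A * p.2
  have hφmod (p : Σ _ : ℕ, ℕ) (hp : p.1 < A) : φ p % A = p.1 := by
    have : φ p % A = b p.1 % A := by simp [φ]
    rw [this, hb p.1 hp, Nat.mod_eq_of_lt hp]
  have hset : {j | b (j % A) ≤ j ∧ j + s < e ((j + s) % A)} = ↑(T.image φ) := by
    ext j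
    simp only [Set.mem_ofPred_eq, Finset.coe_image, Set.mem_image, Finset.mem_coe]
    constructor
    · rintro ⟨h1, h2⟩
      have hj := Nat.mod_lt j hA
      obtain ⟨k, hk⟩ := (Nat.modEq_iff_dvd' h1).1 ((hb _ hj).trans (Nat.mod_modEq _ _))
      refine ⟨⟨j % A, k⟩, ?_, by simp only [φ]; omega⟩
      simp only [T, Finset.mem_sigma, Finset.mem_range]
      refine ⟨hj, ?_⟩
      have h3 := hN _ hj
      rw [Nat.mod_add_mod] at h3
      refine Nat.lt_of_mul_lt_mul_left (a := A) ?_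
      omega
    · rintro ⟨p, hp, rfl⟩
      simp only [T, Finset.mem_sigma, Finset.mem_range] at hp
      have h3 := hN _ hp.1
      have h4 : (φ p + s) % A = (p.1 + s) % A := by
        rw [← Nat.mod_add_mod, hφmod p hp.1]
      rw [hφmod p hp.1, h4]
      have h5 : A * p.2 < A * N p.1 := Nat.mul_lt_mul_of_pos_left hp.2 hA
      simp only [φ]
      omega
  have hinj : Set.InjOn φ T := by
    intro p hp q hq h
    simp only [T, Finset.mem_coe, Finset.mem_sigma, Finset.mem_range] at hp hq
    have h1 : p.1 = q.1 := by rw [← hφmod p hp.1, ← hφmod q hq.1, h]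
    obtain ⟨i, k⟩ := p
    obtain ⟨i', k'⟩ := q
    simp only at h1
    subst h1
    have : k = k' := Nat.eq_of_mul_eq_mul_left hA (by simpa [φ] using h)
    rw [this]
  rw [hset]
  refine ⟨Finset.finite_toSet _, ?_⟩
  rw [Set.ncard_coe_finset, Finset.card_image_of_injOn hinj, Finset.card_sigma, Finset.mul_sum]
  push_cast
  refine Finset.sum_congr rfl fun i hi ↦ ?_
  have h1 : max ((e ((i + s) % A) : ℤ) - b i - s) 0 = ((A * N i : ℕ) : ℤ) := by
    rw [hN i (Finset.mem_range.1 hi)]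
    omega
  have hA' : (A : ℝ) ≠ 0 := by exact_mod_cast hA.ne'
  have h2 := congrArg (Int.cast : ℤ → ℝ) h1
  push_cast at h2
  rw [h2, Finset.card_range]
  field_simp

end Counting

/-! ### Equality of the two bounds, and one-point codes as codes `C_Γ`. -/

variable {t : ℕ} [NeZero t] {Q : Place K F} {n : ℕ} {P : Fin n → Place K F} {a : Fin t → ℕ}
  {x : Fin t → F} {η : ℕ → F}

section FunctionField

variable [Algebra (RatFunc K) F] [IsScalarTower K (RatFunc K) F] [FunctionField K F]

namespace IsGenerating

theorem eta_spec (hg : IsGenerating Q a x) (hQ : Q.IsRational)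
    (hPinj : Function.Injective P) (hPQ : ∀ k, P k ≠ Q)
    {i : ℕ} {f : F} (hf : IsEta Q P a x i f) :
    ∃ e : ℕ, Q.negOrd f = e ∧ e ≡ i [MOD a 0] ∧
      ∀ m : ℕ, m % a 0 = i → ((∃ h ∈ idealSpace Q P, h ≠ 0 ∧ Q.negOrd h = m) ↔ e ≤ m) := by
  obtain ⟨hfI, j, hj, hmin⟩ := hf
  obtain ⟨hi, hfR, hf0, hfj⟩ := hg.of_hasLeadingMonomial hj
  have hmod (j : ℕ) : a 0 * j + apery Q a i ≡ i [MOD a 0] :=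
    (by simp [Nat.ModEq] : a 0 * j + apery Q a i ≡ apery Q a i [MOD a 0]).trans
      (hg.apery_spec i).2
  refine ⟨_, hfj, hmod j, fun m hm ↦ ⟨?_, fun hle ↦ ?_⟩⟩
  · rintro ⟨h, hI, h0, hh⟩
    have hR := ((mem_idealSpace hPinj hPQ).1 hI).1
    obtain ⟨j', hj'⟩ := hg.exists_degree_eq (mem_weierstrass.2 ⟨h, hR, h0, hh⟩)
    rw [hm] at hj'
    have := hmin h hI j' (hg.hasLeadingMonomial_of_negOrd hQ hR h0 hi (by rw [hh, hj']))
    simp only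
    rw [hj']
    gcongr
  · obtain ⟨k, hk⟩ := (Nat.modEq_iff_dvd' hle).1
      ((hmod j).trans (by rw [← hm]; exact Nat.mod_modEq _ _))
    have hx0 := hg.ne_zero (0 : Fin t)
    -- Powers of `x₁` reach every later pole order in the class, and the product still vanishes at
    -- every `P_k`.
    refine ⟨x 0 ^ k * f, ?_, mul_ne_zero (pow_ne_zero _ hx0) hf0, ?_⟩
    · rw [mem_idealSpace hPinj hPQ] at hfI ⊢
      have hxR := pow_mem (hg.mem_regularAway 0) k
      refine ⟨Subalgebra.mul_mem _ hxR hfR, fun l ↦ ?_⟩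
      rw [map_mul]
      exact mul_lt_one_of_nonneg_of_lt_one_right (hxR _ (hPQ l)) zero_le (hfI.2 l)
    · rw [Q.negOrd_mul (pow_ne_zero _ hx0) hf0, Q.negOrd_pow hx0, hg.negOrd_generator, hfj]
      simp only at hk
      have : m = a 0 * k + (a 0 * j + apery Q a i) := by
        rw [← hk, Nat.sub_add_cancel hle]
      rw [this]
      push_cast
      ring

theorem finite_lambdaSet_and_nu_eq (hg : IsGenerating Q a x) (hQ : Q.IsRational)
    (hPinj : Function.Injective P) (hP : ∀ k, (P k).IsRational) (hPQ : ∀ k, P k ≠ Q)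
    (hη : ∀ i, i < a 0 → IsEta Q P a x i (η i)) {s : ℕ} (hs : s ∈ weierstrass Q) :
    (lambdaSet Q P s).Finite ∧ nu Q a x η s = (lambda Q P s : ℝ) := by
  have hA := hg.pos (0 : Fin t)
  choose! e he hei hem using fun i hi ↦ hg.eta_spec hQ hPinj hPQ (hη i hi)
  have hhat {m : ℕ} (hm : m ∈ weierstrass Q) : m ∈ hatH Q P ↔ m < e (m % a 0) := by
    rw [← not_le, ← hem _ (Nat.mod_lt m hA) m rfl,
      ← code_eq_code_sub_one_iff hPinj hQ hP hPQ hm]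
    exact and_iff_right hm
  have hset : lambdaSet Q P s =
      {j | apery Q a (j % a 0) ≤ j ∧ j + s < e ((j + s) % a 0)} := by
    ext j
    simp only [lambdaSet, Set.mem_ofPred_eq]
    rw [← hg.mem_weierstrass_iff]
    exact and_congr_right fun hj ↦ hhat (hg.add_mem hj hs)
  have := finite_and_ncard_eq_sum hA (fun i _ ↦ (hg.apery_spec i).2) hei s
  rw [← hset] at this
  refine ⟨this.1, ?_⟩
  rw [lambda, ← this.2, nu]
  congr 1
  refine Finset.sum_congr rfl fun i _ ↦ ?_
  rw [he _ (Nat.mod_lt _ hA), hg.negOrd_y]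

theorem dLBAO_eq_dAG (hg : IsGenerating Q a x) (hQ : Q.IsRational)
    (hPinj : Function.Injective P) (hP : ∀ k, (P k).IsRational) (hPQ : ∀ k, P k ≠ Q)
    (hη : ∀ i, i < a 0 → IsEta Q P a x i (η i)) {Γ : Set ℕ} (hΓ : Γ ⊆ weierstrass Q)
    (hne : Γ.Nonempty) : dLBAO Q a x η Γ = (dAG Q P Γ : ℝ) := by
  have himg : nu Q a x η '' Γ = (fun m : ℕ ↦ (m : ℝ)) '' (lambda Q P '' Γ) := by
    rw [Set.image_image]
    exact Set.image_congr fun s hs ↦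
      (hg.finite_lambdaSet_and_nu_eq hQ hPinj hP hPQ hη (hΓ hs)).2
  have hmem := Nat.sInf_mem (hne.image (lambda Q P))
  rw [dLBAO, dAG, himg]
  refine IsLeast.csInf_eq ⟨⟨_, hmem, rfl⟩, ?_⟩
  rintro _ ⟨m, hm, rfl⟩
  exact Nat.cast_le.2 (Nat.sInf_le hm)

theorem phi_spec (hg : IsGenerating Q a x) {s : ℕ} (hs : s ∈ weierstrass Q) :
    phi Q a x s ∈ regularAway Q ∧ phi Q a x s ≠ 0 ∧ Q.negOrd (phi Q a x s) = s := by
  have h : ∃ p : ℕ × ℕ, p.2 < a 0 ∧ Q.negOrd (x 0 ^ p.1 * y Q a x p.2) = (s : ℤ) := by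
    obtain ⟨j, hj⟩ := hg.exists_degree_eq hs
    exact ⟨(j, s % a 0), Nat.mod_lt _ (hg.pos 0), by rw [hg.negOrd_monomial, ← hj]⟩
  rw [phi, dif_pos h]
  exact ⟨hg.monomial_mem_regularAway _ _, hg.monomial_ne_zero _ _, h.choose_spec.2⟩

/-- Stated for `C_{u-1}` so that the induction starts at `C_{-1} = 0`. A step outside `Ĥ(Q)` leaves
the code unchanged; a step inside adds `ev(φ_u)`. -/
theorem ev_mem_codeOf (hg : IsGenerating Q a x) (hQ : Q.IsRational)
    (hP : ∀ k, (P k).IsRational) (hPQ : ∀ k, P k ≠ Q) (u : ℕ) {v : Fin n → K} :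
    v ∈ code Q P ((u : ℤ) - 1) → v ∈ codeOf Q P a x {s ∈ hatH Q P | s < u} := by
  induction u generalizing v with
  | zero =>
    intro hv
    rw [Nat.cast_zero, zero_sub, code_neg_one hP hPQ] at hv
    rw [Set.mem_singleton_iff.1 hv]
    exact Submodule.zero_mem _
  | succ u ih =>
    intro hv
    have hle : codeOf Q P a x {s ∈ hatH Q P | s < u} ≤ codeOf Q P a x {s ∈ hatH Q P | s < u + 1} :=
      Submodule.span_mono (Set.image_mono fun s hs ↦ ⟨hs.1, by have := hs.2; omega⟩)
    rw [Nat.cast_succ, add_sub_cancel_right] at hv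
    by_cases hu : u ∈ hatH Q P
    · obtain ⟨f, hf, rfl⟩ := hv
      rw [mem_rrSpace_single] at hf
      by_cases h0 : f = 0 ∨ Q.negOrd f < u
      · refine hle (ih ⟨f, mem_rrSpace_single.2 (h0.imp_right fun h ↦ ⟨?_, by omega⟩), rfl⟩)
        exact hf.elim (fun h ↦ h ▸ Subalgebra.zero_mem _) And.left
      · push Not at h0
        obtain ⟨hfR, hfu⟩ := hf.resolve_left h0.1
        obtain ⟨hφ, hφ0, hφu⟩ := hg.phi_spec hu.1
        obtain ⟨c, -, r, hr, hfr, hlt⟩ := hQ.exists_eq_const_mul_add hfR hφ h0.1 hφ0 (by omega)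
        rw [hfr, ev_add hP hPQ (Subalgebra.mul_mem _ (Subalgebra.algebraMap_mem _ c) hφ) hr,
          ev_const_mul hP hPQ c hφ]
        refine Submodule.add_mem _ (Submodule.smul_mem _ _ (Submodule.subset_span
          ⟨u, ⟨hu, Nat.lt_succ_self u⟩, rfl⟩)) (hle (ih ⟨r, mem_rrSpace_single.2 ?_, rfl⟩))
        exact hlt.imp_right fun h ↦ ⟨hr, by omega⟩
    · refine hle (ih ?_)
      by_cases huH : u ∈ weierstrass Q
      · have : code Q P (u : ℤ) = code Q P ((u : ℤ) - 1) := by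
          by_contra h
          exact hu ⟨huH, h⟩
        rwa [← this]
      · obtain ⟨f, hf, rfl⟩ := hv
        refine ⟨f, mem_rrSpace_single.2 ?_, rfl⟩
        by_cases h0 : f = 0
        · exact Or.inl h0
        obtain ⟨hfR, hfu⟩ := (mem_rrSpace_single.1 hf).resolve_left h0
        refine Or.inr ⟨hfR, ?_⟩
        have : Q.negOrd f ≠ u := fun h ↦ huH (mem_weierstrass.2 ⟨f, hfR, h0, h⟩)
        omega

theorem codeOf_eq_code (hg : IsGenerating Q a x) (hQ : Q.IsRational)
    (hP : ∀ k, (P k).IsRational) (hPQ : ∀ k, P k ≠ Q) (u : ℕ) :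
    (codeOf Q P a x {s ∈ hatH Q P | s ≤ u} : Set (Fin n → K)) = code Q P (u : ℤ) := by
  refine Set.Subset.antisymm (fun v hv ↦ ?_) fun v hv ↦ ?_
  · have hR {f : F} (hf : f ∈ rrSpace (Finsupp.single Q (u : ℤ))) : f ∈ regularAway Q :=
      (mem_rrSpace_single.1 hf).elim (fun h ↦ h ▸ Subalgebra.zero_mem _) And.left
    -- In terms of `Q.val` the zero function needs no separate case, which makes closure under sums
    -- immediate.
    have hval {f : F} : f ∈ rrSpace (Finsupp.single Q (u : ℤ)) ↔
        f ∈ regularAway Q ∧ Q.val f ≤ WithZero.exp (u : ℤ) := by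
      refine ⟨fun hf ↦ ⟨hR hf, ?_⟩, fun hf ↦ mem_rrSpace_single.2 ?_⟩
      · by_cases h0 : f = 0
        · simp [h0]
        · rw [Q.val_eq_exp h0, WithZero.exp_le_exp]
          exact ((mem_rrSpace_single.1 hf).resolve_left h0).2
      · by_cases h0 : f = 0
        · exact Or.inl h0
        · rw [Q.val_eq_exp h0, WithZero.exp_le_exp] at hf
          exact Or.inr hf
    induction hv using Submodule.span_induction with
    | mem v hv =>
      obtain ⟨s, ⟨hs, hsu⟩, rfl⟩ := hv
      obtain ⟨hφ, hφ0, hφs⟩ := hg.phi_spec hs.1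
      exact ⟨_, mem_rrSpace_single.2 (Or.inr ⟨hφ, by rw [hφs]; exact_mod_cast hsu⟩), rfl⟩
    | zero => exact ⟨0, mem_rrSpace_single.2 (Or.inl rfl), ev_zero hP hPQ⟩
    | add v w _ _ hv hw =>
      obtain ⟨f, hf, rfl⟩ := hv
      obtain ⟨g, hg', rfl⟩ := hw
      rw [hval] at hf hg'
      exact ⟨f + g, hval.2 ⟨Subalgebra.add_mem _ hf.1 hg'.1, Q.val.map_add_le hf.2 hg'.2⟩,
        ev_add hP hPQ hf.1 hg'.1⟩
    | smul c v _ hv =>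
      obtain ⟨f, hf, rfl⟩ := hv
      rw [hval] at hf
      refine ⟨algebraMap K F c * f, hval.2 ⟨Subalgebra.mul_mem _ (Subalgebra.algebraMap_mem _ c)
        hf.1, ?_⟩, ev_const_mul hP hPQ c hf.1⟩
      rw [map_mul]
      exact (mul_le_of_le_one_left' (Q.val_algebraMap_le c)).trans hf.2
  · have := hg.ev_mem_codeOf hQ hP hPQ (u + 1) (v := v) (by simpa using hv)
    simpa only [Nat.lt_succ_iff, SetLike.mem_coe] using this

end IsGenerating

end FunctionField

end OnePointCode

open OnePointCode in
theorem proposition1 {K F : Type*} [Field K] [Finite K] [Field F] [Algebra K F]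
    [Algebra (RatFunc K) F] [IsScalarTower K (RatFunc K) F] [FunctionField K F]
    -- the places `Q, P₁, …, Pₙ`, distinct and of degree one
    {n : ℕ} (hn : 0 < n) (Q : Place K F) (P : Fin n → Place K F)
    (hQ : Q.IsRational) (hP : ∀ k, (P k).IsRational)
    (hPinj : Function.Injective P) (hPQ : ∀ k, P k ≠ Q)
    -- generators `a₁, …, a_t` of the Weierstrass semigroup and functions `x_i` realizing them
    {t : ℕ} [NeZero t] (a : Fin t → ℕ) (ha : ∀ i, 0 < a i)
    (hgen : (AddSubmonoid.closure (Set.range a) : Set ℕ) = weierstrass Q)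
    (x : Fin t → F) (hx : ∀ i, HasPoleDivisor (x i) (Finsupp.single Q (a i : ℤ)))
    -- any admissible choice of `η_0, …, η_{a₁ - 1}`
    (η : ℕ → F) (hη : ∀ i, i < a 0 → IsEta Q P a x i (η i)) :
    (∀ Γ : Set ℕ, Γ ⊆ hatH Q P →
      (∀ s ∈ Γ, (lambdaSet Q P s).Finite ∧ nu Q a x η s = (lambda Q P s : ℝ)) ∧
      (Γ.Nonempty →
        dLBAO Q a x η Γ = (dAG Q P Γ : ℝ) ∧
        ⌊(dLBAO Q a x η Γ - 1) / 2⌋ = ⌊((dAG Q P Γ : ℝ) - 1) / 2⌋)) ∧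
    (∀ u : ℕ,
      {s ∈ hatH Q P | s ≤ u}.Nonempty ∧
      (codeOf Q P a x {s ∈ hatH Q P | s ≤ u} : Set (Fin n → K)) = code Q P (u : ℤ) ∧
      dLBAO Q a x η {s ∈ hatH Q P | s ≤ u} = (dAG Q P {s ∈ hatH Q P | s ≤ u} : ℝ) ∧
      ((∀ s ∈ weierstrass Q, s ≤ u → s ∈ hatH Q P) →
        dLBAO Q a x η {s ∈ weierstrass Q | s ≤ u} =
            (dAG Q P {s ∈ hatH Q P | s ≤ u} : ℝ) ∧
        ⌊(dLBAO Q a x η {s ∈ weierstrass Q | s ≤ u} - 1) / 2⌋ =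
          ⌊((dAG Q P {s ∈ hatH Q P | s ≤ u} : ℝ) - 1) / 2⌋)) := by
  have hg : IsGenerating Q a x := ⟨ha, hgen, hx⟩
  have hH : hatH Q P ⊆ weierstrass Q := fun _ h ↦ h.1
  have hne (u : ℕ) : {s ∈ hatH Q P | s ≤ u}.Nonempty :=
    ⟨0, zero_mem_hatH hn hP hPQ, Nat.zero_le u⟩
  have hd (u : ℕ) : dLBAO Q a x η {s ∈ hatH Q P | s ≤ u} = (dAG Q P {s ∈ hatH Q P | s ≤ u} : ℝ) :=
    hg.dLBAO_eq_dAG hQ hPinj hP hPQ hη (fun s hs ↦ hH hs.1) (hne u)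
  refine ⟨fun Γ hΓ ↦ ⟨fun s hs ↦ ?_, fun hΓne ↦ ?_⟩, fun u ↦ ⟨hne u, ?_, hd u, fun hu ↦ ?_⟩⟩
  · exact hg.finite_lambdaSet_and_nu_eq hQ hPinj hP hPQ hη (hH (hΓ hs))
  · have h := hg.dLBAO_eq_dAG hQ hPinj hP hPQ hη (hΓ.trans hH) hΓne
    exact ⟨h, by rw [h]⟩
  · exact hg.codeOf_eq_code hQ hP hPQ u
  · have hset : {s ∈ weierstrass Q | s ≤ u} = {s ∈ hatH Q P | s ≤ u} :=
      Set.ext fun s ↦ ⟨fun hs ↦ ⟨hu s hs.1 hs.2, hs.2⟩, fun hs ↦ ⟨hH hs.1, hs.2⟩⟩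
    rw [hset]
    exact ⟨hd u, by rw [hd u]⟩
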